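/- Let $m\ge 3$ be an integer, $\lambda=\lambda_m=2\cos(\pi/m)$, and $$L=\begin{pmatrix}1&0\\ \lambda&1\end{pmatrix},\quad S=\begin{pmatrix}0&-1\\1&0\end{pmatrix},\quad R=L^{-1}S .$$ For $j=1,\dots,m-1$ put $$A_j=SR^{-j},\quad B_j=LA_jL^{-1},\quad C_j=\begin{pmatrix}\frac1{m-1}&\frac{j-1}{m-1}\\0&1\end{pmatrix}.$$ The matrices $B_j$ and $C_j$ act by fractional linear transformations on $[0,\lambda^{-1}]$ and on $[0,1]$, respectively. For every sequence $\omega\in\{1,\dots,m-1\}^{\mathbb Z_{\ge0}}$ there are unique points $\pi_B(\omega)\in[0,\lambda^{-1}]$ and $\pi_C(\omega)\in[0,1]$ with $$\bigcap_{n\ge0}B_{\omega(0)}\cdots B_{\omega(n-1)}[0,\lambda^{-1}]=\{\pi_B(\omega)\},\qquad \bigcap_{n\ge0}C_{\omega(0)}\cdots C_{\omega(n-1)}[0,1]=\{\pi_C(\omega)\};$$ the map $\pi_B$ is onto $[0,\lambda^{-1}]$, and $\pi_C(\omega)$ depends only on $\pi_B(\omega)$, so that the Minkowski function $M_m=\pi_C\circ\pi_B^{-1}:[0,\lambda^{-1}]\to[0,1]$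 is well defined. Let $\|\cdot\|_2$ be the operator norm induced by the Euclidean norm. The joint spectral radius of a finite set $\mathscr D$ of real square matrices of the same size is $$\tilde\rho(\mathscr D)=\limsup_{n\to\infty}\max\bigl\{\|D\|_2^{1/n}: D\text{ is a product of } n\text{ elements of }\mathscr D\bigr\}.$$ Set $$\rho_m=\|A_{\lfloor m/2\rfloor}\|_2,\qquad \alpha_m=\frac{\log(m-1)}{2\log\rho_m}.$$ Then: 1. $\tilde\rho(\{A_1,\dots,A_{m-1}\})=\rho_m$; 2. $M_m$ is Hölder continuous of exponent $\alpha_m$ on $[0,\lambda^{-1}]$, that is, there is a constant $K$ with $|M_m(x)-M_m(y)|\le K|x-y|^{\alpha_m}$ for all $x,y\in[0,\lambda^{-1}]$; and $M_m$ is not Hölder continuous of exponent $\beta$ for any $\beta>\alpha_m$. -/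

import Mathlib

namespace HeckeMinkowski

noncomputable section

/-- `λ_m = 2 cos(π/m)`. -/
def lam (m : ℕ) : ℝ := 2 * Real.cos (Real.pi / m)

def L (m : ℕ) : Matrix (Fin 2) (Fin 2) ℝ := !![1, 0; lam m, 1]

def S : Matrix (Fin 2) (Fin 2) ℝ := !![0, -1; 1, 0]

def R (m : ℕ) : Matrix (Fin 2) (Fin 2) ℝ := (L m)⁻¹ * S

def A (m j : ℕ) : Matrix (Fin 2) (Fin 2) ℝ := S * (R m)⁻¹ ^ j

def B (m j : ℕ) : Matrix (Fin 2) (Fin 2) ℝ := L m * A m j * (L m)⁻¹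

def C (m j : ℕ) : Matrix (Fin 2) (Fin 2) ℝ :=
  !![1 / ((m : ℝ) - 1), ((j : ℝ) - 1) / ((m : ℝ) - 1); 0, 1]

/-- The projective action of a real `2 × 2` matrix of positive determinant on real points. -/
def mobius (D : Matrix (Fin 2) (Fin 2) ℝ) (x : ℝ) : ℝ :=
  (D 0 0 * x + D 0 1) / (D 1 0 * x + D 1 1)

/-- The level-`n` cylinder `D_{ω(0)} ∘ D_{ω(1)} ∘ ⋯ ∘ D_{ω(n-1)} [X]`. -/
def cylinder (D : ℕ → ℝ → ℝ) (X : Set ℝ) : (ℕ → ℕ) → ℕ → Set ℝ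
  | _, 0 => X
  | ω, n + 1 => D (ω 0) '' cylinder D X (fun k => ω (k + 1)) n

/-- The coding map `π_D` of an iterated function system `D` on `X`: the point `x` such that
`⋂_{n ≥ 0} D_{ω(0)} ⋯ D_{ω(n-1)} [X] = {x}`. -/
def coding (D : ℕ → ℝ → ℝ) (X : Set ℝ) (ω : ℕ → ℕ) : ℝ :=
  Classical.epsilon fun x => ⋂ n, cylinder D X ω n = {x}

/-- The sequences `{1, …, m-1}^{ℤ_{≥0}}`. -/
def digitSeq (m : ℕ) : Set (ℕ → ℕ) := {ω | ∀ n, ω n ∈ Set.Icc 1 (m - 1)}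

/-- The interval `[0, λ_m⁻¹]`. -/
def dom (m : ℕ) : Set ℝ := Set.Icc 0 (lam m)⁻¹

def actB (m j : ℕ) : ℝ → ℝ := mobius (B m j)

def actC (m j : ℕ) : ℝ → ℝ := mobius (C m j)

def piB (m : ℕ) : (ℕ → ℕ) → ℝ := coding (actB m) (dom m)

def piC (m : ℕ) : (ℕ → ℕ) → ℝ := coding (actC m) (Set.Icc 0 1)

/-- The Minkowski function `M_m = π_C ∘ π_B⁻¹`, meaningful on `[0, λ_m⁻¹]`. -/
def minkowski (m : ℕ) : ℝ → ℝ := piC m ∘ Function.invFunOn (piB m) (digitSeq m)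

/-- The operator norm of a real square matrix induced by the Euclidean norm. -/
def norm2 {d : ℕ} (D : Matrix (Fin d) (Fin d) ℝ) : ℝ :=
  ‖Matrix.toEuclideanCLM (n := Fin d) (𝕜 := ℝ) D‖

/-- The joint spectral radius of a finite set of real square matrices. -/
def jointSpectralRadius {d : ℕ} (𝒟 : Set (Matrix (Fin d) (Fin d) ℝ)) : ℝ :=
  Filter.limsup
    (fun n : ℕ => sSup {r : ℝ | ∃ l : List (Matrix (Fin d) (Fin d) ℝ),
      l.length = n ∧ (∀ D ∈ l, D ∈ 𝒟) ∧ r = norm2 l.prod ^ (1 / (n : ℝ))})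
    Filter.atTop

/-- `ρ_m = ‖A_{⌊m/2⌋}‖₂`. -/
def rho (m : ℕ) : ℝ := norm2 (A m (m / 2))

/-- `α_m = log (m-1) / (2 log ρ_m)`. -/
def alpha (m : ℕ) : ℝ := Real.log ((m : ℝ) - 1) / (2 * Real.log (rho m))

end

end HeckeMinkowski

/-! Each `A_j` has determinant `1` and nonnegative entries, its transpose is `A_{m-j}`, and
`tr(A_jᵀ A_j) = (λ sin(jπ/m) / sin(π/m))² + 2`. Hence `D = A_{⌊m/2⌋}` has the largest norm `ρ` among
the `A_j`, and since `Dᵀ` is also one of them, the products `(DᵀD)ⁿ`, of norm `ρ²ⁿ`, show that the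
joint spectral radius is `ρ` itself.

A level-`n` cylinder of the maps `C_j` has length `(m-1)⁻ⁿ`. One of the maps `B_j` has length
`(cd)⁻¹`, where `(c, d)` is the bottom row of `L A_{ω(0)} ⋯ A_{ω(n-1)}`; so its length is at least a
constant times `ρ⁻²ⁿ`, and for the word `Dᵀ, D, Dᵀ, D, …` it is at most a constant times `ρ⁻²ⁿ`.
As `M_m` carries cylinders to cylinders and `(ρ²)^α = m - 1`, both halves of the Hölder statement
follow. The lower bound on the lengths also shows that `π_B` determines `π_C`.
-/

namespace HeckeMinkowski

open Real Set Filter Topology Matrix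
open scoped Matrix.Norms.L2Operator

noncomputable section

/-! ### The joint spectral radius -/

section JointSpectralRadius

variable {d : ℕ} {D : Matrix (Fin d) (Fin d) ℝ} {𝒟 : Set (Matrix (Fin d) (Fin d) ℝ)}

theorem norm2_eq_norm (D : Matrix (Fin d) (Fin d) ℝ) : norm2 D = ‖D‖ :=
  l2_opNorm_toEuclideanCLM D

theorem norm2_nonneg (D : Matrix (Fin d) (Fin d) ℝ) : 0 ≤ norm2 D := norm_nonneg _

theorem isSelfAdjoint_transpose_mul_self (D : Matrix (Fin d) (Fin d) ℝ) :
    IsSelfAdjoint (Dᵀ * D) := by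
  simpa [star_eq_conjTranspose] using IsSelfAdjoint.star_mul_self D

theorem norm_transpose_mul_self (D : Matrix (Fin d) (Fin d) ℝ) :
    ‖Dᵀ * D‖ = norm2 D ^ 2 := by
  rw [norm2_eq_norm, sq, ← l2_opNorm_conjTranspose_mul_self,
    conjTranspose_eq_transpose_of_trivial]

theorem norm2_transpose_mul_self_pow_two_pow (D : Matrix (Fin d) (Fin d) ℝ) (n : ℕ) :
    norm2 ((Dᵀ * D) ^ 2 ^ n) = norm2 D ^ (2 * 2 ^ n) := by
  rw [norm2_eq_norm, (isSelfAdjoint_transpose_mul_self D).norm_pow_two_pow,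
    norm_transpose_mul_self, pow_mul]

theorem norm2_list_prod_le {t : ℝ} (ht : 0 ≤ t) (l : List (Matrix (Fin d) (Fin d) ℝ))
    (hl : ∀ D ∈ l, norm2 D ≤ t) : norm2 l.prod ≤ t ^ l.length := by
  induction l with
  | nil =>
    rw [List.prod_nil, List.length_nil, pow_zero, norm2, map_one]
    exact ContinuousLinearMap.norm_id_le
  | cons D l ih =>
    rw [List.forall_mem_cons] at hl
    rw [List.prod_cons, List.length_cons, pow_succ', norm2_eq_norm]
    refine (l2_opNorm_mul D l.prod).trans ?_
    rw [← norm2_eq_norm, ← norm2_eq_norm]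
    exact mul_le_mul hl.1 (ih hl.2) (norm2_nonneg _) ht

/-- The numbers `‖D‖₂ ^ (1 / n)`, for `D` a product of `n` elements of `𝒟`: the joint spectral
radius of `𝒟` is the upper limit of their suprema. -/
def rootNorms (𝒟 : Set (Matrix (Fin d) (Fin d) ℝ)) (n : ℕ) : Set ℝ :=
  {r | ∃ l : List (Matrix (Fin d) (Fin d) ℝ),
    l.length = n ∧ (∀ D ∈ l, D ∈ 𝒟) ∧ r = norm2 l.prod ^ (1 / (n : ℝ))}

theorem nonneg_of_mem_rootNorms {n : ℕ} {r : ℝ} (hr : r ∈ rootNorms 𝒟 n) : 0 ≤ r := by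
  obtain ⟨l, -, -, rfl⟩ := hr
  exact rpow_nonneg (norm2_nonneg _) _

theorem le_of_mem_rootNorms {t : ℝ} (ht : 0 ≤ t) (hmax : ∀ E ∈ 𝒟, norm2 E ≤ t) {n : ℕ}
    (hn : n ≠ 0) {r : ℝ} (hr : r ∈ rootNorms 𝒟 n) : r ≤ t := by
  obtain ⟨l, rfl, hl, rfl⟩ := hr
  calc norm2 l.prod ^ (1 / (l.length : ℝ)) ≤ (t ^ l.length) ^ (1 / (l.length : ℝ)) := by
        have := norm2_list_prod_le ht l fun E hE => hmax E (hl E hE)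
        gcongr
        exact norm2_nonneg _
    _ = t := by rw [one_div, pow_rpow_inv_natCast ht hn]

theorem norm2_mem_rootNorms (hD : D ∈ 𝒟) (hDt : Dᵀ ∈ 𝒟) (n : ℕ) :
    norm2 D ∈ rootNorms 𝒟 (2 * 2 ^ n) := by
  refine ⟨(List.replicate (2 ^ n) [Dᵀ, D]).flatten, by simp [mul_comm], fun E hE => ?_, ?_⟩
  · obtain ⟨l, hl, hEl⟩ := List.mem_flatten.1 hE
    rw [List.eq_of_mem_replicate hl] at hEl
    rcases List.mem_pair.1 hEl with rfl | rfl
    exacts [hDt, hD]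
  · rw [List.prod_flatten, List.map_replicate, List.prod_replicate, List.prod_pair,
      norm2_transpose_mul_self_pow_two_pow, one_div,
      pow_rpow_inv_natCast (norm2_nonneg D) (by positivity)]

theorem jointSpectralRadius_eq_norm2 (hD : D ∈ 𝒟) (hDt : Dᵀ ∈ 𝒟)
    (hmax : ∀ E ∈ 𝒟, norm2 E ≤ norm2 D) : jointSpectralRadius 𝒟 = norm2 D := by
  have hle {n : ℕ} (hn : n ≠ 0) {r : ℝ} (hr : r ∈ rootNorms 𝒟 n) : r ≤ norm2 D :=
    le_of_mem_rootNorms (norm2_nonneg D) hmax hn hr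
  have hupper : ∀ᶠ n in atTop, sSup (rootNorms 𝒟 n) ≤ norm2 D := by
    filter_upwards [eventually_ne_atTop 0] with n hn
    exact Real.sSup_le (fun _ => hle hn) (norm2_nonneg D)
  have hlower : ∃ᶠ n in atTop, norm2 D ≤ sSup (rootNorms 𝒟 n) := by
    refine frequently_atTop.2 fun n => ⟨2 * 2 ^ n, by have := n.lt_two_pow_self; lia, ?_⟩
    exact le_csSup ⟨norm2 D, fun _ => hle (by positivity)⟩ (norm2_mem_rootNorms hD hDt n)
  have hnonneg (n : ℕ) : 0 ≤ sSup (rootNorms 𝒟 n) :=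
    Real.sSup_nonneg fun _ => nonneg_of_mem_rootNorms
  exact le_antisymm (limsup_le_of_le (isCoboundedUnder_le_of_le atTop hnonneg) hupper)
    (le_limsup_of_frequently_le hlower ⟨norm2 D, hupper⟩)

end JointSpectralRadius

/-! ### Unimodular `2 × 2` matrices -/

section Unimodular

theorem isGreatest_spectrum_transpose_mul_self {d : ℕ} [NeZero d]
    (D : Matrix (Fin d) (Fin d) ℝ) : IsGreatest (spectrum ℝ (Dᵀ * D)) (norm2 D ^ 2) := by
  obtain ⟨⟨x, hx, hnorm⟩, hmax⟩ :=
    IsometricContinuousFunctionalCalculus.isGreatest_norm_spectrum (𝕜 := ℝ) (Dᵀ * D)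
      (isSelfAdjoint_transpose_mul_self D)
  rw [norm_transpose_mul_self] at hnorm hmax
  have hpos : (Dᵀ * D).PosSemidef := by
    simpa using posSemidef_conjTranspose_mul_self D
  have hx0 : 0 ≤ x := (posSemidef_iff_isHermitian_and_spectrum_nonneg.1 hpos).2 hx
  have hxD : x = norm2 D ^ 2 := (norm_of_nonneg hx0).symm.trans hnorm
  exact ⟨hxD ▸ hx, fun y hy => (le_abs_self y).trans (hmax ⟨y, hy, rfl⟩)⟩

variable {D E : Matrix (Fin 2) (Fin 2) ℝ}

theorem mem_spectrum_transpose_mul_self_iff (hD : D.det = 1) {x : ℝ} :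
    x ∈ spectrum ℝ (Dᵀ * D) ↔ x ^ 2 - (Dᵀ * D).trace * x + 1 = 0 := by
  rw [mem_spectrum_iff_isRoot_charpoly, charpoly_fin_two]
  simp [hD]

theorem trace_sub_norm2_sq_mem_spectrum (hD : D.det = 1) :
    (Dᵀ * D).trace - norm2 D ^ 2 ∈ spectrum ℝ (Dᵀ * D) := by
  have h := (mem_spectrum_transpose_mul_self_iff hD).1
    (isGreatest_spectrum_transpose_mul_self D).1
  rw [mem_spectrum_transpose_mul_self_iff hD, ← h]
  ring

theorem norm2_sq_mul_trace_sub (hD : D.det = 1) :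
    norm2 D ^ 2 * ((Dᵀ * D).trace - norm2 D ^ 2) = 1 := by
  have h := (mem_spectrum_transpose_mul_self_iff hD).1
    (isGreatest_spectrum_transpose_mul_self D).1
  linarith

theorem one_le_norm2 (hD : D.det = 1) : 1 ≤ norm2 D := by
  have hle := (isGreatest_spectrum_transpose_mul_self D).2 (trace_sub_norm2_sq_mem_spectrum hD)
  have hmul := norm2_sq_mul_trace_sub hD
  by_contra! hlt
  have : norm2 D ^ 2 < 1 := pow_lt_one₀ (norm2_nonneg D) hlt two_ne_zero
  nlinarith [sq_nonneg (norm2 D)]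

theorem trace_transpose_mul_self (hD : D.det = 1) :
    (Dᵀ * D).trace = norm2 D ^ 2 + (norm2 D ^ 2)⁻¹ := by
  rw [← eq_inv_of_mul_eq_one_right (norm2_sq_mul_trace_sub hD)]
  ring

theorem one_lt_norm2 (hD : D.det = 1) (h : 2 < (Dᵀ * D).trace) : 1 < norm2 D := by
  refine (one_le_norm2 hD).lt_of_ne fun hone => ?_
  rw [trace_transpose_mul_self hD, ← hone] at h
  norm_num at h

theorem norm2_le_norm2_of_trace_le (hD : D.det = 1) (hE : E.det = 1)
    (h : (Dᵀ * D).trace ≤ (Eᵀ * E).trace) : norm2 D ≤ norm2 E := by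
  by_contra! hlt
  rw [trace_transpose_mul_self hD, trace_transpose_mul_self hE] at h
  have hE1 : 1 ≤ norm2 E ^ 2 := one_le_pow₀ (one_le_norm2 hE)
  have hED : norm2 E ^ 2 < norm2 D ^ 2 := pow_lt_pow_left₀ hlt (norm2_nonneg E) two_ne_zero
  have hfactor : norm2 D ^ 2 + (norm2 D ^ 2)⁻¹ - (norm2 E ^ 2 + (norm2 E ^ 2)⁻¹) =
      (norm2 D ^ 2 - norm2 E ^ 2) * (1 - (norm2 D ^ 2 * norm2 E ^ 2)⁻¹) := by
    have hE0 : norm2 E ≠ 0 := by rintro h0; norm_num [h0] at hE1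
    have hD0 : norm2 D ≠ 0 := ((norm2_nonneg E).trans_lt hlt).ne'
    field_simp
    ring
  have hinv : (norm2 D ^ 2 * norm2 E ^ 2)⁻¹ < 1 :=
    inv_lt_one_of_one_lt₀ (one_lt_mul_of_lt_of_le (hE1.trans_lt hED) hE1)
  have := mul_pos (sub_pos.2 hED) (sub_pos.2 hinv)
  linarith

theorem mul_self_eq_trace_smul_sub_one (hD : D.det = 1) : D * D = D.trace • D - 1 := by
  have h := aeval_self_charpoly D
  rw [charpoly_fin_two] at h
  simp only [map_add, map_sub, map_mul, Polynomial.aeval_X, Polynomial.aeval_C, hD,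
    map_one, ← Algebra.smul_def, sq] at h
  rw [← sub_eq_zero, ← h]
  abel

variable {ι : Type*} {τ : ℝ}

theorem mul_pow_succ_sub_inv_smul (hτ : τ ≠ 0) (hD : D.det = 1) (htr : D.trace = τ + τ⁻¹)
    (M : Matrix ι (Fin 2) ℝ) (n : ℕ) :
    M * D ^ (n + 1) - τ⁻¹ • (M * D ^ n) = τ ^ n • (M * D - τ⁻¹ • M) := by
  induction n with
  | zero => simp
  | succ n ih =>
    have hstep : D ^ 2 - τ⁻¹ • D = τ • (D - τ⁻¹ • 1) := by
      rw [sq, mul_self_eq_trace_smul_sub_one hD, htr, smul_sub, smul_smul, mul_inv_cancel₀ hτ,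
        add_smul, one_smul]
      abel
    calc M * D ^ (n + 1 + 1) - τ⁻¹ • (M * D ^ (n + 1))
        = M * (D ^ n * (D ^ 2 - τ⁻¹ • D)) := by
          simp only [mul_sub, Matrix.mul_sub, mul_smul_comm, Matrix.mul_smul, ← pow_add,
            ← pow_succ, add_assoc, one_add_one_eq_two]
      _ = τ • (M * D ^ (n + 1) - τ⁻¹ • (M * D ^ n)) := by
          rw [hstep]
          simp only [mul_sub, Matrix.mul_sub, mul_smul_comm, Matrix.mul_smul, pow_succ, mul_one]
      _ = τ ^ (n + 1) • (M * D - τ⁻¹ • M) := by rw [ih, smul_smul, pow_succ']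

theorem le_mul_pow_succ_apply (hτ : 1 < τ) (hD : D.det = 1) (htr : D.trace = τ + τ⁻¹)
    {M : Matrix ι (Fin 2) ℝ} {i : ι} {j : Fin 2} (hM : 1 ≤ M i j) (hMD : M i j ≤ (M * D) i j)
    {n : ℕ} (hn : 0 ≤ (M * D ^ n) i j) :
    (1 - τ⁻¹) * τ ^ n ≤ (M * D ^ (n + 1)) i j := by
  have hτ0 : 0 < τ := one_pos.trans hτ
  have hτ1 : τ⁻¹ < 1 := inv_lt_one_of_one_lt₀ hτ
  have h := Matrix.ext_iff.2 (mul_pow_succ_sub_inv_smul hτ0.ne' hD htr M n) i j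
  simp only [Matrix.sub_apply, Matrix.smul_apply, smul_eq_mul] at h
  calc (1 - τ⁻¹) * τ ^ n ≤ (1 - τ⁻¹) * M i j * τ ^ n := by
        gcongr
        exact le_mul_of_one_le_right (sub_nonneg.2 hτ1.le) hM
    _ ≤ τ ^ n * ((M * D) i j - τ⁻¹ * M i j) := by
        rw [mul_comm (τ ^ n)]
        gcongr
        linarith
    _ ≤ (M * D ^ (n + 1)) i j := by
        rw [← h]
        exact sub_le_self _ (by positivity)

end Unimodular

/-! ### The ratios `sin (xπ/m) / sin (π/m)` -/

/-- The ratio `sin (xπ/m) / sin (π/m)`: at integers it is a Chebyshev polynomial of the second kind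
in `λ_m / 2`, and these values are the entries of the matrices `A m j`. -/
def sinRatio (m : ℕ) (x : ℝ) : ℝ := sin (x * (π / m)) / sin (π / m)

section SinRatio

variable {m : ℕ} {x y : ℝ}

theorem nat_mul_pi_div (hm : m ≠ 0) : (m : ℝ) * (π / m) = π :=
  mul_div_cancel₀ π (Nat.cast_ne_zero.2 hm)

theorem sin_pi_div_pos (hm : 2 ≤ m) : 0 < sin (π / m) := by
  have hm1 : (1 : ℝ) < m := by exact_mod_cast hm
  exact sin_pos_of_pos_of_lt_pi (by positivity) (div_lt_self pi_pos hm1)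

@[simp]
theorem sinRatio_zero : sinRatio m 0 = 0 := by simp [sinRatio]

theorem sinRatio_one (hm : 2 ≤ m) : sinRatio m 1 = 1 := by
  rw [sinRatio, one_mul, div_self (sin_pi_div_pos hm).ne']

theorem sinRatio_self_sub (hm : 2 ≤ m) (x : ℝ) : sinRatio m (m - x) = sinRatio m x := by
  rw [sinRatio, sub_mul, nat_mul_pi_div (Nat.ne_zero_of_lt hm), sin_pi_sub, sinRatio]

theorem sinRatio_self (hm : 2 ≤ m) : sinRatio m m = 0 := by
  simpa using sinRatio_self_sub hm 0

theorem sinRatio_add_one_add_sub_one (x : ℝ) :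
    sinRatio m (x + 1) + sinRatio m (x - 1) = lam m * sinRatio m x := by
  simp only [sinRatio, lam, add_mul, sub_mul, one_mul, sin_add, sin_sub]
  ring

theorem sinRatio_sq_sub_mul (hm : 2 ≤ m) (x : ℝ) :
    sinRatio m x ^ 2 - sinRatio m (x - 1) * sinRatio m (x + 1) = 1 := by
  have hne := (sin_pi_div_pos hm).ne'
  have hprod : sin (x * (π / m)) ^ 2 - sin (x * (π / m) - π / m) * sin (x * (π / m) + π / m) =
      sin (π / m) ^ 2 := by
    rw [sin_sub, sin_add]
    linear_combination sin (π / m) ^ 2 * sin_sq_add_cos_sq (x * (π / m)) -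
      sin (x * (π / m)) ^ 2 * sin_sq_add_cos_sq (π / m)
  simp only [sinRatio, add_mul, sub_mul, one_mul]
  rw [div_pow, div_mul_div_comm, ← sq, ← sub_div, hprod, div_self (pow_ne_zero 2 hne)]

theorem sinRatio_nonneg (hm : 2 ≤ m) (h0 : 0 ≤ x) (h1 : x ≤ m) : 0 ≤ sinRatio m x := by
  refine div_nonneg (sin_nonneg_of_nonneg_of_le_pi (by positivity) ?_) (sin_pi_div_pos hm).le
  calc x * (π / m) ≤ m * (π / m) := by gcongr
    _ = π := nat_mul_pi_div (Nat.ne_zero_of_lt hm)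

theorem sinRatio_mono (hm : 2 ≤ m) (h0 : 0 ≤ x) (hxy : x ≤ y) (hy : 2 * y ≤ m) :
    sinRatio m x ≤ sinRatio m y := by
  have hx : 0 ≤ x * (π / m) := by positivity
  have hyπ : y * (π / m) ≤ π / 2 := by
    calc y * (π / m) ≤ m / 2 * (π / m) := by gcongr; linarith
      _ = π / 2 := by rw [div_mul_eq_mul_div, nat_mul_pi_div (Nat.ne_zero_of_lt hm)]
  refine div_le_div_of_nonneg_right (sin_le_sin_of_le_of_le_pi_div_two ?_ hyπ ?_)
    (sin_pi_div_pos hm).le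
  · linarith [pi_pos]
  · gcongr

theorem one_le_sinRatio (hm : 2 ≤ m) (h1 : 1 ≤ x) (h2 : x ≤ m - 1) : 1 ≤ sinRatio m x := by
  rw [← sinRatio_one hm]
  rcases le_total (2 * x) m with h | h
  · exact sinRatio_mono hm zero_le_one h1 h
  · rw [← sinRatio_self_sub hm x]
    exact sinRatio_mono hm zero_le_one (by linarith) (by linarith)

theorem sinRatio_le_half (hm : 2 ≤ m) {j : ℕ} (hj : j ≤ m) :
    sinRatio m j ≤ sinRatio m (m / 2 : ℕ) := by
  have hhalf : 2 * ((m / 2 : ℕ) : ℝ) ≤ m := by exact_mod_cast Nat.mul_div_le m 2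
  rcases le_total (2 * j) m with h | h
  · have hle : j ≤ m / 2 := by lia
    exact sinRatio_mono hm (by positivity) (by exact_mod_cast hle) hhalf
  · have hle : m - j ≤ m / 2 := by lia
    rw [← sinRatio_self_sub hm j, ← Nat.cast_sub hj]
    exact sinRatio_mono hm (by positivity) (by exact_mod_cast hle) hhalf

end SinRatio

section Digits

variable {m j : ℕ}

theorem natCast_le_sub_one (hj : j ∈ Icc 1 (m - 1)) : (j : ℝ) ≤ m - 1 := by
  have hjm : j + 1 ≤ m := by have := hj.1; have := hj.2; lia
  rw [le_sub_iff_add_le]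
  exact_mod_cast hjm

theorem one_le_natCast (hj : j ∈ Icc 1 (m - 1)) : (1 : ℝ) ≤ j := by exact_mod_cast hj.1

theorem one_le_sinRatio_digit (hm : 2 ≤ m) (hj : j ∈ Icc 1 (m - 1)) : 1 ≤ sinRatio m j :=
  one_le_sinRatio hm (one_le_natCast hj) (natCast_le_sub_one hj)

theorem sinRatio_digit_sub_one_nonneg (hm : 2 ≤ m) (hj : j ∈ Icc 1 (m - 1)) :
    0 ≤ sinRatio m (j - 1) :=
  sinRatio_nonneg hm (by linarith [one_le_natCast hj]) (by linarith [natCast_le_sub_one hj])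

theorem sinRatio_digit_add_one_nonneg (hm : 2 ≤ m) (hj : j ∈ Icc 1 (m - 1)) :
    0 ≤ sinRatio m (j + 1) :=
  sinRatio_nonneg hm (by positivity) (by linarith [natCast_le_sub_one hj])

theorem half_mem_digits (hm : 2 ≤ m) : m / 2 ∈ Icc 1 (m - 1) := ⟨by lia, by lia⟩

theorem sub_half_mem_digits (hm : 2 ≤ m) : m - m / 2 ∈ Icc 1 (m - 1) := ⟨by lia, by lia⟩

end Digits

/-! ### The matrices `A_j` -/

section Matrices

variable {m : ℕ}

theorem one_le_lam (hm : 2 < m) : 1 ≤ lam m := by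
  have hm3 : (3 : ℝ) ≤ m := by exact_mod_cast hm
  have hcos : cos (π / 3) ≤ cos (π / m) :=
    cos_le_cos_of_nonneg_of_le_pi (by positivity) (by linarith [pi_pos]) (by gcongr)
  rw [cos_pi_div_three] at hcos
  rw [lam]
  linarith

theorem lam_pos (hm : 2 < m) : 0 < lam m := one_pos.trans_le (one_le_lam hm)

theorem L_inv : (L m)⁻¹ = !![1, 0; -lam m, 1] := by
  refine inv_eq_right_inv ?_
  simp [L, one_fin_two]

theorem R_inv : (R m)⁻¹ = !![lam m, 1; -1, 0] := by
  refine inv_eq_right_inv ?_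
  simp [R, L_inv, S, one_fin_two]

theorem R_inv_pow (hm : 2 ≤ m) (j : ℕ) :
    (R m)⁻¹ ^ j = !![sinRatio m (j + 1), sinRatio m j; -sinRatio m j, -sinRatio m (j - 1)] := by
  induction j with
  | zero =>
    have hneg : sinRatio m (-1) = -1 := by
      have h := sinRatio_add_one_add_sub_one (m := m) 0
      rw [zero_add, zero_sub, sinRatio_zero, mul_zero, sinRatio_one hm] at h
      linarith
    simp [sinRatio_one hm, hneg, one_fin_two]
  | succ j ih =>
    have h1 := sinRatio_add_one_add_sub_one (m := m) j
    have h2 := sinRatio_add_one_add_sub_one (m := m) (j + 1)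
    rw [add_sub_cancel_right] at h2
    rw [pow_succ, ih, R_inv, mul_fin_two]
    ext i k
    fin_cases i <;> fin_cases k <;> simp <;> linarith

theorem A_eq (hm : 2 ≤ m) (j : ℕ) :
    A m j = !![sinRatio m j, sinRatio m (j - 1); sinRatio m (j + 1), sinRatio m j] := by
  simp [A, R_inv_pow hm, S]

theorem det_A (hm : 2 ≤ m) (j : ℕ) : (A m j).det = 1 := by
  rw [A_eq hm, det_fin_two_of]
  linarith [sinRatio_sq_sub_mul hm j]

theorem transpose_A (hm : 2 ≤ m) {j : ℕ} (hj : j ≤ m) : (A m j)ᵀ = A m (m - j) := by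
  rw [A_eq hm, A_eq hm, Nat.cast_sub hj, sinRatio_self_sub hm,
    show (m : ℝ) - j - 1 = m - (j + 1) by ring, show (m : ℝ) - j + 1 = m - (j - 1) by ring,
    sinRatio_self_sub hm, sinRatio_self_sub hm]
  exact (etaExpand_eq _).symm

theorem trace_transpose_mul_self_A (hm : 2 ≤ m) (j : ℕ) :
    ((A m j)ᵀ * A m j).trace = (lam m * sinRatio m j) ^ 2 + 2 := by
  have hdet := sinRatio_sq_sub_mul hm j
  rw [← sinRatio_add_one_add_sub_one, A_eq hm]
  simp only [trace_fin_two, mul_apply, transpose_apply, Fin.sum_univ_two, of_apply, cons_val',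
    cons_val_zero, cons_val_one, cons_val_fin_one]
  linear_combination 2 * hdet

theorem norm2_A_le_rho (hm : 2 < m) {j : ℕ} (hj : j ≤ m) : norm2 (A m j) ≤ rho m := by
  refine norm2_le_norm2_of_trace_le (det_A hm.le j) (det_A hm.le _) ?_
  rw [trace_transpose_mul_self_A hm.le, trace_transpose_mul_self_A hm.le]
  have hnonneg := sinRatio_nonneg hm.le (x := j) (by positivity) (by exact_mod_cast hj)
  have hle := sinRatio_le_half hm.le hj
  have hlam := lam_pos hm
  gcongr

theorem one_lt_rho (hm : 2 < m) : 1 < rho m := by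
  refine one_lt_norm2 (det_A hm.le _) ?_
  rw [trace_transpose_mul_self_A hm.le]
  have hs := one_le_sinRatio_digit hm.le (half_mem_digits hm.le)
  have hlam := lam_pos hm
  exact lt_add_of_pos_left 2 (by positivity)

theorem jointSpectralRadius_A (hm : 2 < m) :
    jointSpectralRadius (A m '' Icc 1 (m - 1)) = rho m := by
  refine jointSpectralRadius_eq_norm2 ⟨_, half_mem_digits hm.le, rfl⟩
    ⟨_, sub_half_mem_digits hm.le, (transpose_A hm.le (Nat.div_le_self m 2)).symm⟩ ?_
  rintro _ ⟨j, hj, rfl⟩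
  exact norm2_A_le_rho hm (hj.2.trans (Nat.sub_le m 1))

end Matrices

/-! ### Tilings of an interval -/

section WordMap

variable {m : ℕ} {D : ℕ → ℝ → ℝ} {a b : ℝ} {ω : ℕ → ℕ}

/-- The composition `D_{ω(0)} ∘ D_{ω(1)} ∘ ⋯ ∘ D_{ω(n-1)}`. -/
def wordMap (D : ℕ → ℝ → ℝ) : (ℕ → ℕ) → ℕ → ℝ → ℝ
  | _, 0 => id
  | ω, n + 1 => D (ω 0) ∘ wordMap D (fun k => ω (k + 1)) n

/-- The length of the level-`n` cylinder of the sequence `ω`, when the maps `D j` are continuous and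
monotone on `[a, b]`. -/
def cylinderWidth (D : ℕ → ℝ → ℝ) (a b : ℝ) (ω : ℕ → ℕ) (n : ℕ) : ℝ :=
  wordMap D ω n b - wordMap D ω n a

theorem cylinder_eq_image (D : ℕ → ℝ → ℝ) (X : Set ℝ) (ω : ℕ → ℕ) (n : ℕ) :
    cylinder D X ω n = wordMap D ω n '' X := by
  induction n generalizing ω with
  | zero => exact (image_id X).symm
  | succ n ih => rw [cylinder, ih, wordMap, image_comp]

theorem shift_mem_digitSeq (hω : ω ∈ digitSeq m) : (fun k => ω (k + 1)) ∈ digitSeq m :=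
  fun n => hω (n + 1)

/-- The maps `D 1, …, D (m - 1)` carry `[a, b]` monotonically onto consecutive intervals that
together fill `[a, b]`. -/
structure IsTiling (m : ℕ) (D : ℕ → ℝ → ℝ) (a b : ℝ) : Prop where
  two_le : 2 ≤ m
  le : a ≤ b
  continuousOn : ∀ j ∈ Icc 1 (m - 1), ContinuousOn (D j) (Icc a b)
  monotoneOn : ∀ j ∈ Icc 1 (m - 1), MonotoneOn (D j) (Icc a b)
  map_left : D 1 a = a
  map_right : D (m - 1) b = b
  map_succ_left : ∀ j ∈ Ico 1 (m - 1), D (j + 1) a = D j b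

/-- A tiling all of whose cylinders shrink to points, so that `coding` is meaningful. -/
structure IsShrinkingTiling (m : ℕ) (D : ℕ → ℝ → ℝ) (a b : ℝ) : Prop
    extends IsTiling m D a b where
  tendsto_cylinderWidth :
    ∀ ω ∈ digitSeq m, Tendsto (cylinderWidth D a b ω) atTop (𝓝 0)

end WordMap

namespace IsTiling

variable {m j k : ℕ} {D : ℕ → ℝ → ℝ} {a b x : ℝ} {ω : ℕ → ℕ} (hD : IsTiling m D a b)
include hD

theorem left_mem : a ∈ Icc a b := left_mem_Icc.2 hD.le

theorem right_mem : b ∈ Icc a b := right_mem_Icc.2 hD.le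

theorem one_mem_digits : 1 ∈ Icc 1 (m - 1) := ⟨le_rfl, Nat.le_sub_one_of_lt hD.two_le⟩

theorem sub_one_mem_digits : m - 1 ∈ Icc 1 (m - 1) := ⟨Nat.le_sub_one_of_lt hD.two_le, le_rfl⟩

theorem map_left_le_map_right (hj : j ∈ Icc 1 (m - 1)) : D j a ≤ D j b :=
  hD.monotoneOn j hj hD.left_mem hD.right_mem hD.le

theorem map_right_le_map_left (hj : 1 ≤ j) (hjk : j < k) (hk : k ≤ m - 1) : D j b ≤ D k a := by
  induction k, hjk using Nat.le_induction with
  | base => exact (hD.map_succ_left j ⟨hj, hk⟩).ge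
  | succ k hjk ih =>
    have hk1 : 1 ≤ k := hj.trans (Nat.le_of_succ_le hjk)
    calc D j b ≤ D k a := ih (Nat.le_of_succ_le hk)
      _ ≤ D k b := hD.map_left_le_map_right ⟨hk1, Nat.le_of_succ_le hk⟩
      _ = D (k + 1) a := (hD.map_succ_left k ⟨hk1, hk⟩).symm

theorem left_le_map_left (hj : j ∈ Icc 1 (m - 1)) : a ≤ D j a := by
  rcases hj.1.eq_or_lt with rfl | h
  · exact hD.map_left.ge
  · calc a = D 1 a := hD.map_left.symm
      _ ≤ D 1 b := hD.map_left_le_map_right hD.one_mem_digits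
      _ ≤ D j a := hD.map_right_le_map_left le_rfl h hj.2

theorem map_right_le_right (hj : j ∈ Icc 1 (m - 1)) : D j b ≤ b := by
  rcases hj.2.eq_or_lt with rfl | h
  · exact hD.map_right.le
  · calc D j b ≤ D (m - 1) a := hD.map_right_le_map_left hj.1 h le_rfl
      _ ≤ D (m - 1) b := hD.map_left_le_map_right hD.sub_one_mem_digits
      _ = b := hD.map_right

theorem mapsTo (hj : j ∈ Icc 1 (m - 1)) : MapsTo (D j) (Icc a b) (Icc a b) := fun _ hx =>
  ⟨(hD.left_le_map_left hj).trans (hD.monotoneOn j hj hD.left_mem hx hx.1),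
    (hD.monotoneOn j hj hx hD.right_mem hx.2).trans (hD.map_right_le_right hj)⟩

theorem exists_map_eq (hx : x ∈ Icc a b) : ∃ j ∈ Icc 1 (m - 1), ∃ y ∈ Icc a b, D j y = x := by
  suffices h : ∀ k, 1 ≤ k → k ≤ m - 1 → x ≤ D k b →
      ∃ j ∈ Icc 1 (m - 1), x ∈ Icc (D j a) (D j b) by
    obtain ⟨j, hj, hxj⟩ := h (m - 1) hD.sub_one_mem_digits.1 le_rfl (hD.map_right.symm ▸ hx.2)
    exact ⟨j, hj, intermediate_value_Icc hD.le (hD.continuousOn j hj) hxj⟩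
  intro k hk
  induction k, hk using Nat.le_induction with
  | base => exact fun h1 hxk => ⟨1, ⟨le_rfl, h1⟩, hD.map_left.symm ▸ hx.1, hxk⟩
  | succ k hk ih =>
    intro hkm hxk
    rcases le_total x (D k b) with h | h
    · exact ih (Nat.le_of_succ_le hkm) h
    · exact ⟨k + 1, ⟨by lia, hkm⟩, (hD.map_succ_left k ⟨hk, hkm⟩).symm ▸ h, hxk⟩

theorem mapsTo_wordMap (hω : ω ∈ digitSeq m) (n : ℕ) :
    MapsTo (wordMap D ω n) (Icc a b) (Icc a b) := by
  induction n generalizing ω with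
  | zero => exact mapsTo_id _
  | succ n ih => exact (hD.mapsTo (hω 0)).comp (ih (shift_mem_digitSeq hω))

theorem monotoneOn_wordMap (hω : ω ∈ digitSeq m) (n : ℕ) :
    MonotoneOn (wordMap D ω n) (Icc a b) := by
  induction n generalizing ω with
  | zero => exact monotone_id.monotoneOn _
  | succ n ih =>
    have hω' := shift_mem_digitSeq hω
    exact (hD.monotoneOn _ (hω 0)).comp (ih hω') (hD.mapsTo_wordMap hω' n)

theorem continuousOn_wordMap (hω : ω ∈ digitSeq m) (n : ℕ) :
    ContinuousOn (wordMap D ω n) (Icc a b) := by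
  induction n generalizing ω with
  | zero => exact continuousOn_id
  | succ n ih =>
    have hω' := shift_mem_digitSeq hω
    exact (hD.continuousOn _ (hω 0)).comp (ih hω') (hD.mapsTo_wordMap hω' n)

theorem wordMap_left_le_wordMap_right (hω : ω ∈ digitSeq m) (n : ℕ) :
    wordMap D ω n a ≤ wordMap D ω n b :=
  hD.monotoneOn_wordMap hω n hD.left_mem hD.right_mem hD.le

theorem cylinder_eq_Icc (hω : ω ∈ digitSeq m) (n : ℕ) :
    cylinder D (Icc a b) ω n = Icc (wordMap D ω n a) (wordMap D ω n b) := by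
  rw [cylinder_eq_image]
  exact (hD.continuousOn_wordMap hω n).image_Icc_of_monotoneOn hD.le (hD.monotoneOn_wordMap hω n)

theorem cylinder_subset (hω : ω ∈ digitSeq m) (n : ℕ) :
    cylinder D (Icc a b) ω n ⊆ Icc a b := by
  rw [cylinder_eq_image]
  exact (hD.mapsTo_wordMap hω n).image_subset

theorem cylinder_succ_subset (hω : ω ∈ digitSeq m) (n : ℕ) :
    cylinder D (Icc a b) ω (n + 1) ⊆ cylinder D (Icc a b) ω n := by
  induction n generalizing ω with
  | zero => exact hD.cylinder_subset hω 1
  | succ n ih => exact image_mono (ih (shift_mem_digitSeq hω))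

theorem nonempty_iInter_cylinder (hω : ω ∈ digitSeq m) :
    (⋂ n, cylinder D (Icc a b) ω n).Nonempty := by
  have hcyl := hD.cylinder_eq_Icc hω
  refine IsCompact.nonempty_iInter_of_sequence_nonempty_isCompact_isClosed _
    (hD.cylinder_succ_subset hω) (fun n => ?_) ?_ fun n => ?_
  · rw [hcyl, nonempty_Icc]
    exact hD.wordMap_left_le_wordMap_right hω n
  · rw [hcyl]
    exact isCompact_Icc
  · rw [hcyl]
    exact isClosed_Icc

theorem exists_forall_mem_cylinder (hx : x ∈ Icc a b) :
    ∃ ω ∈ digitSeq m, ∀ n, x ∈ cylinder D (Icc a b) ω n := by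
  choose! d hd T hT hdT using fun x (hx : x ∈ Icc a b) => hD.exists_map_eq hx
  have hiter (n : ℕ) : T^[n] x ∈ Icc a b := MapsTo.iterate (fun y hy => hT y hy) n hx
  refine ⟨fun n => d (T^[n] x), fun n => hd _ (hiter n), fun n => ?_⟩
  clear hiter
  induction n generalizing x with
  | zero => exact hx
  | succ n ih => exact ⟨T x, ih (hT x hx), hdT x hx⟩

end IsTiling

namespace IsShrinkingTiling

variable {m : ℕ} {D : ℕ → ℝ → ℝ} {a b x : ℝ} {ω : ℕ → ℕ} (hD : IsShrinkingTiling m D a b)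
include hD

theorem subsingleton_iInter_cylinder (hω : ω ∈ digitSeq m) :
    (⋂ n, cylinder D (Icc a b) ω n).Subsingleton := by
  intro x hx y hy
  rw [mem_iInter] at hx hy
  have hle (n : ℕ) : |x - y| ≤ cylinderWidth D a b ω n := by
    have hxn := hx n
    have hyn := hy n
    rw [hD.cylinder_eq_Icc hω] at hxn hyn
    exact abs_sub_le_of_le_of_le hxn.1 hxn.2 hyn.1 hyn.2
  have hzero : |x - y| ≤ 0 := ge_of_tendsto' (hD.tendsto_cylinderWidth ω hω) hle
  exact sub_eq_zero.1 (abs_nonpos_iff.1 hzero)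

theorem iInter_cylinder_eq_coding (hω : ω ∈ digitSeq m) :
    ⋂ n, cylinder D (Icc a b) ω n = {coding D (Icc a b) ω} :=
  Classical.epsilon_spec (p := fun x => ⋂ n, cylinder D (Icc a b) ω n = {x})
    (exists_eq_singleton_iff_nonempty_subsingleton.2
      ⟨hD.nonempty_iInter_cylinder hω, hD.subsingleton_iInter_cylinder hω⟩)

theorem coding_mem_cylinder (hω : ω ∈ digitSeq m) (n : ℕ) :
    coding D (Icc a b) ω ∈ cylinder D (Icc a b) ω n :=
  mem_iInter.1 (hD.iInter_cylinder_eq_coding hω ▸ mem_singleton _) n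

theorem eq_coding (hω : ω ∈ digitSeq m) (hx : ∀ n, x ∈ cylinder D (Icc a b) ω n) :
    x = coding D (Icc a b) ω := by
  rw [← mem_singleton_iff, ← hD.iInter_cylinder_eq_coding hω]
  exact mem_iInter.2 hx

theorem image_coding_digitSeq : coding D (Icc a b) '' digitSeq m = Icc a b := by
  refine Subset.antisymm ?_ fun x hx => ?_
  · rintro _ ⟨ω, hω, rfl⟩
    exact hD.coding_mem_cylinder hω 0
  · obtain ⟨ω, hω, hxω⟩ := hD.exists_forall_mem_cylinder hx
    exact ⟨ω, hω, (hD.eq_coding hω hxω).symm⟩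

theorem coding_eq_map_coding_shift (hω : ω ∈ digitSeq m) :
    coding D (Icc a b) ω = D (ω 0) (coding D (Icc a b) fun k => ω (k + 1)) := by
  have hmem := hD.coding_mem_cylinder (shift_mem_digitSeq hω)
  refine (hD.eq_coding hω fun n => ?_).symm
  cases n with
  | zero => exact hD.mapsTo (hω 0) (hmem 0)
  | succ n => exact mem_image_of_mem _ (hmem n)

end IsShrinkingTiling

/-! ### The position of a cylinder among those of its level -/

/-- The number of words of length `n` in the digits `1, …, q` that precede `ω(0) ⋯ ω(n-1)`. -/
def wordIndex (q : ℕ) : (ℕ → ℕ) → ℕ → ℕ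
  | _, 0 => 0
  | ω, n + 1 => (ω 0 - 1) * q ^ n + wordIndex q (fun k => ω (k + 1)) n

section WordIndex

variable {m n : ℕ} {ω ω' : ℕ → ℕ}

theorem wordIndex_succ (q : ℕ) (ω : ℕ → ℕ) (n : ℕ) :
    wordIndex q ω (n + 1) = wordIndex q ω n * q + (ω n - 1) := by
  induction n generalizing ω with
  | zero => simp [wordIndex]
  | succ n ih => rw [wordIndex, ih, wordIndex]; ring

theorem wordIndex_congr (q : ℕ) (h : ∀ i < n, ω i = ω' i) :
    wordIndex q ω n = wordIndex q ω' n := by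
  induction n with
  | zero => rfl
  | succ n ih =>
    rw [wordIndex_succ, wordIndex_succ, ih fun i hi => h i (hi.trans n.lt_succ_self),
      h n n.lt_succ_self]

theorem wordIndex_lt (hω : ω ∈ digitSeq m) (n : ℕ) : wordIndex (m - 1) ω n < (m - 1) ^ n := by
  induction n with
  | zero => exact one_pos
  | succ n ih =>
    have hdigit : ω n - 1 < m - 1 := by have := hω n; simp only [mem_Icc] at this; lia
    rw [wordIndex_succ, pow_succ]
    calc wordIndex (m - 1) ω n * (m - 1) + (ω n - 1)
        < wordIndex (m - 1) ω n * (m - 1) + (m - 1) := by gcongr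
      _ = (wordIndex (m - 1) ω n + 1) * (m - 1) := by ring
      _ ≤ (m - 1) ^ n * (m - 1) := Nat.mul_le_mul_right _ ih

theorem exists_wordIndex_eq (hm : 2 ≤ m) {N : ℕ} (hN : N < (m - 1) ^ n) :
    ∃ ω ∈ digitSeq m, wordIndex (m - 1) ω n = N := by
  induction n generalizing N with
  | zero =>
    exact ⟨fun _ => 1, fun _ => ⟨le_rfl, Nat.le_sub_one_of_lt hm⟩, (Nat.lt_one_iff.1 hN).symm⟩
  | succ n ih =>
    rw [pow_succ'] at hN
    obtain ⟨ω, hω, hωN⟩ := ih (Nat.div_lt_of_lt_mul hN)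
    have hmod : N % (m - 1) < m - 1 := Nat.mod_lt N (by lia)
    refine ⟨fun i => if i < n then ω i else N % (m - 1) + 1, fun i => ?_, ?_⟩
    · dsimp only
      split_ifs
      exacts [hω i, ⟨Nat.le_add_left 1 _, hmod⟩]
    · rw [wordIndex_succ, wordIndex_congr (ω' := ω) _ fun i hi => if_pos hi, hωN]
      simpa using Nat.div_add_mod' N (m - 1)

end WordIndex

namespace IsTiling

variable {m n : ℕ} {D : ℕ → ℝ → ℝ} {a b x y : ℝ} {ω ω' : ℕ → ℕ} (hD : IsTiling m D a b)
include hD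

theorem le_of_wordIndex_lt (hω : ω ∈ digitSeq m) (hω' : ω' ∈ digitSeq m)
    (h : wordIndex (m - 1) ω n < wordIndex (m - 1) ω' n)
    (hx : x ∈ cylinder D (Icc a b) ω n) (hy : y ∈ cylinder D (Icc a b) ω' n) : x ≤ y := by
  induction n generalizing ω ω' x y with
  | zero => exact absurd h (lt_irrefl 0)
  | succ n ih =>
    obtain ⟨x, hx, rfl⟩ := hx
    obtain ⟨y, hy, rfl⟩ := hy
    have hs := shift_mem_digitSeq hω
    have hs' := shift_mem_digitSeq hω'
    have hxI := hD.cylinder_subset hs n hx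
    have hyI := hD.cylinder_subset hs' n hy
    rw [wordIndex, wordIndex] at h
    rcases lt_trichotomy (ω 0) (ω' 0) with h0 | h0 | h0
    · calc D (ω 0) x ≤ D (ω 0) b := hD.monotoneOn _ (hω 0) hxI hD.right_mem hxI.2
        _ ≤ D (ω' 0) a := hD.map_right_le_map_left (hω 0).1 h0 (hω' 0).2
        _ ≤ D (ω' 0) y := hD.monotoneOn _ (hω' 0) hD.left_mem hyI hyI.1
    · rw [h0] at h ⊢
      exact hD.monotoneOn _ (hω' 0) hxI hyI (ih hs hs' (by lia) hx hy)
    · refine absurd h (not_lt.2 ?_)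
      calc (ω' 0 - 1) * (m - 1) ^ n + wordIndex (m - 1) (fun k => ω' (k + 1)) n
          ≤ (ω' 0 - 1) * (m - 1) ^ n + (m - 1) ^ n := by
            gcongr
            exact (wordIndex_lt hs' n).le
        _ = (ω' 0 - 1 + 1) * (m - 1) ^ n := by ring
        _ ≤ (ω 0 - 1) * (m - 1) ^ n := by
            have := (hω' 0).1
            gcongr
            lia
        _ ≤ _ := Nat.le_add_right _ _

theorem exists_cylinderWidth_le_sub (hω : ω ∈ digitSeq m) (hω' : ω' ∈ digitSeq m)
    (h : wordIndex (m - 1) ω n + 2 ≤ wordIndex (m - 1) ω' n)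
    (hx : x ∈ cylinder D (Icc a b) ω n) (hy : y ∈ cylinder D (Icc a b) ω' n) :
    ∃ υ ∈ digitSeq m, cylinderWidth D a b υ n ≤ y - x := by
  obtain ⟨υ, hυ, hυN⟩ := exists_wordIndex_eq hD.two_le (n := n)
    (N := wordIndex (m - 1) ω n + 1) (by have := wordIndex_lt hω' n; lia)
  have hle := hD.wordMap_left_le_wordMap_right hυ n
  have hcyl := hD.cylinder_eq_Icc hυ n
  have hxleft : x ≤ wordMap D υ n a :=
    hD.le_of_wordIndex_lt hω hυ (by lia) hx (hcyl ▸ left_mem_Icc.2 hle)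
  have hright_y : wordMap D υ n b ≤ y :=
    hD.le_of_wordIndex_lt hυ hω' (by lia) (hcyl ▸ right_mem_Icc.2 hle) hy
  exact ⟨υ, hυ, sub_le_sub hright_y hxleft⟩

end IsTiling

/-! ### The maps `C_j` -/

section ActC

variable {m : ℕ} {ω ω' : ℕ → ℕ}

theorem actC_eq (j : ℕ) (x : ℝ) : actC m j x = (x + (j - 1)) / ((m : ℝ) - 1) := by
  simp only [actC, mobius, C, of_apply, cons_val', cons_val_zero, cons_val_one,
    cons_val_fin_one, zero_mul, zero_add, div_one]
  ring

theorem isTiling_actC (hm : 2 ≤ m) : IsTiling m (actC m) 0 1 := by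
  have hm1 : (0 : ℝ) < m - 1 := by
    rw [sub_pos]
    exact_mod_cast hm
  have hactC (j : ℕ) : actC m j = fun x => (x + (j - 1)) / ((m : ℝ) - 1) := funext (actC_eq j)
  refine ⟨hm, zero_le_one, fun j _ => ?_, fun j _ x _ y _ hxy => ?_, ?_, ?_, fun j _ => ?_⟩
  · rw [hactC]
    fun_prop
  · rw [hactC]
    dsimp only
    gcongr
  · simp [actC_eq]
  · rw [actC_eq, Nat.cast_sub (one_le_two.trans hm), Nat.cast_one, add_sub_cancel,
      div_self hm1.ne']
  · rw [actC_eq, actC_eq, Nat.cast_succ]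
    congr 1
    ring

theorem wordMap_actC (hω : ω ∈ digitSeq m) (n : ℕ) (x : ℝ) :
    wordMap (actC m) ω n x = (wordIndex (m - 1) ω n + x) / ((m : ℝ) - 1) ^ n := by
  induction n generalizing ω with
  | zero => simp [wordMap, wordIndex]
  | succ n ih =>
    have h1 := one_le_natCast (hω 0)
    have hm1 : (m : ℝ) - 1 ≠ 0 := by linarith [natCast_le_sub_one (hω 0)]
    have hm : 1 ≤ m := by have := hω 0; simp only [mem_Icc] at this; lia
    rw [wordMap, Function.comp_apply, ih (shift_mem_digitSeq hω), actC_eq, wordIndex]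
    push_cast [Nat.cast_sub (hω 0).1, Nat.cast_sub hm]
    field_simp
    ring

theorem cylinderWidth_actC (hω : ω ∈ digitSeq m) (n : ℕ) :
    cylinderWidth (actC m) 0 1 ω n = (((m : ℝ) - 1) ^ n)⁻¹ := by
  rw [cylinderWidth, wordMap_actC hω, wordMap_actC hω, ← sub_div, add_zero, add_sub_cancel_left,
    one_div]

theorem one_lt_natCast_sub_one (hm : 2 < m) : (1 : ℝ) < m - 1 := by
  have : (2 : ℝ) < m := by exact_mod_cast hm
  linarith

theorem isShrinkingTiling_actC (hm : 2 < m) : IsShrinkingTiling m (actC m) 0 1 where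
  toIsTiling := isTiling_actC hm.le
  tendsto_cylinderWidth ω hω := by
    simp only [funext (cylinderWidth_actC hω)]
    exact (tendsto_pow_atTop_atTop_of_one_lt (one_lt_natCast_sub_one hm)).inv_tendsto_atTop

theorem piC_mem_Icc (hm : 2 < m) (hω : ω ∈ digitSeq m) (n : ℕ) :
    piC m ω ∈ Icc (wordIndex (m - 1) ω n / ((m : ℝ) - 1) ^ n)
      ((wordIndex (m - 1) ω n + 1) / ((m : ℝ) - 1) ^ n) := by
  have h := (isShrinkingTiling_actC hm).coding_mem_cylinder hω n
  rwa [(isTiling_actC hm.le).cylinder_eq_Icc hω, wordMap_actC hω, wordMap_actC hω, add_zero] at h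

theorem wordIndex_add_two_le (hm : 2 < m) (hω : ω ∈ digitSeq m) (hω' : ω' ∈ digitSeq m) {n : ℕ}
    (h : 2 / ((m : ℝ) - 1) ^ n < piC m ω' - piC m ω) :
    wordIndex (m - 1) ω n + 2 ≤ wordIndex (m - 1) ω' n := by
  have hq : (0 : ℝ) < ((m : ℝ) - 1) ^ n := pow_pos (one_pos.trans (one_lt_natCast_sub_one hm)) n
  have hlt : 2 / ((m : ℝ) - 1) ^ n < (wordIndex (m - 1) ω' n + 1) / ((m : ℝ) - 1) ^ n -
      wordIndex (m - 1) ω n / ((m : ℝ) - 1) ^ n :=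
    h.trans_le (sub_le_sub (piC_mem_Icc hm hω' n).2 (piC_mem_Icc hm hω n).1)
  rw [← sub_div, div_lt_div_iff_of_pos_right hq] at hlt
  have : (wordIndex (m - 1) ω n : ℝ) + 1 < wordIndex (m - 1) ω' n := by linarith
  exact_mod_cast this

end ActC

/-! ### Hölder exponents from cylinder widths -/

section WithTail

variable {m j : ℕ} {ω : ℕ → ℕ}

/-- The sequence that agrees with `ω` before time `n` and is constantly `j` from then on; it codes
the point of the level-`n` cylinder of `ω` that comes from the fixed point of `D j`. -/
def withTail (ω : ℕ → ℕ) (n j : ℕ) : ℕ → ℕ := fun i => if i < n then ω i else j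

theorem withTail_mem_digitSeq (hω : ω ∈ digitSeq m) (hj : j ∈ Icc 1 (m - 1)) (n : ℕ) :
    withTail ω n j ∈ digitSeq m := by
  intro i
  unfold withTail
  split_ifs
  exacts [hω i, hj]

theorem withTail_shift (ω : ℕ → ℕ) (n j : ℕ) :
    (fun k => withTail ω (n + 1) j (k + 1)) = withTail (fun k => ω (k + 1)) n j := by
  unfold withTail
  simp only [Nat.add_lt_add_iff_right]

end WithTail

theorem holderOnWith_iff_abs_sub_le {K α : NNReal} {f : ℝ → ℝ} {s : Set ℝ} :
    HolderOnWith K α f s ↔ ∀ x ∈ s, ∀ y ∈ s, |f x - f y| ≤ K * |x - y| ^ (α : ℝ) := by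
  refine forall₄_congr fun x _ y _ => ?_
  rw [edist_dist, edist_dist, ENNReal.ofReal_rpow_of_nonneg dist_nonneg α.coe_nonneg,
    ← ENNReal.ofReal_coe_nnreal, ← ENNReal.ofReal_mul K.coe_nonneg,
    ENNReal.ofReal_le_ofReal_iff (by positivity), Real.dist_eq, Real.dist_eq]

namespace IsShrinkingTiling

variable {m : ℕ} {D : ℕ → ℝ → ℝ} {a b c τ α : ℝ} {ω ω' : ℕ → ℕ} (hD : IsShrinkingTiling m D a b)
include hD

theorem coding_const {j : ℕ} {x : ℝ} (hj : j ∈ Icc 1 (m - 1)) (hx : x ∈ Icc a b)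
    (hfix : D j x = x) : coding D (Icc a b) (fun _ => j) = x := by
  refine (hD.eq_coding (fun _ => hj) fun n => ?_).symm
  induction n with
  | zero => exact hx
  | succ n ih => exact ⟨x, ih, hfix⟩

theorem coding_withTail {j : ℕ} {x : ℝ} (hω : ω ∈ digitSeq m) (hj : j ∈ Icc 1 (m - 1))
    (hx : x ∈ Icc a b) (hfix : D j x = x) (n : ℕ) :
    coding D (Icc a b) (withTail ω n j) = wordMap D ω n x := by
  induction n generalizing ω with
  | zero => exact hD.coding_const hj hx hfix
  | succ n ih =>
    rw [hD.coding_eq_map_coding_shift (withTail_mem_digitSeq hω hj (n + 1)), withTail_shift,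
      ih (shift_mem_digitSeq hω)]
    rfl

theorem map_wordMap_right_sub_map_wordMap_left (hm : 2 < m) {f : ℝ → ℝ}
    (hf : ∀ ω ∈ digitSeq m, f (coding D (Icc a b) ω) = piC m ω) (hω : ω ∈ digitSeq m) (n : ℕ) :
    f (wordMap D ω n b) - f (wordMap D ω n a) = (((m : ℝ) - 1) ^ n)⁻¹ := by
  have hC := isShrinkingTiling_actC hm
  have h1 := hD.one_mem_digits
  have h2 := hD.sub_one_mem_digits
  rw [← hD.coding_withTail hω h1 hD.left_mem hD.map_left,
    ← hD.coding_withTail hω h2 hD.right_mem hD.map_right, hf _ (withTail_mem_digitSeq hω h1 n),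
    hf _ (withTail_mem_digitSeq hω h2 n), piC,
    hC.coding_withTail hω h1 hC.left_mem hC.map_left,
    hC.coding_withTail hω h2 hC.right_mem hC.map_right]
  exact cylinderWidth_actC hω n

theorem inv_pow_le_mul_cylinderWidth_rpow (hm : 2 < m) {f : ℝ → ℝ}
    (hf : ∀ ω ∈ digitSeq m, f (coding D (Icc a b) ω) = piC m ω) (hω : ω ∈ digitSeq m)
    {K β : NNReal} (hK : HolderOnWith K β f (Icc a b)) (n : ℕ) :
    (((m : ℝ) - 1) ^ n)⁻¹ ≤ K * cylinderWidth D a b ω n ^ (β : ℝ) := by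
  have hle := hD.wordMap_left_le_wordMap_right hω n
  have hmap := hD.mapsTo_wordMap hω n
  calc (((m : ℝ) - 1) ^ n)⁻¹ = f (wordMap D ω n b) - f (wordMap D ω n a) :=
        (hD.map_wordMap_right_sub_map_wordMap_left hm hf hω n).symm
    _ ≤ K * |wordMap D ω n b - wordMap D ω n a| ^ (β : ℝ) :=
        (le_abs_self _).trans
          (holderOnWith_iff_abs_sub_le.1 hK _ (hmap hD.right_mem) _ (hmap hD.left_mem))
    _ = K * cylinderWidth D a b ω n ^ (β : ℝ) := by
        rw [abs_of_nonneg (sub_nonneg.2 hle), cylinderWidth]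

theorem not_holderOnWith (hm : 2 < m) {f : ℝ → ℝ}
    (hf : ∀ ω ∈ digitSeq m, f (coding D (Icc a b) ω) = piC m ω) (hω : ω ∈ digitSeq m) (hτ : 1 < τ)
    (hτα : τ ^ α = (m : ℝ) - 1) (hwidth : ∃ᶠ n in atTop, cylinderWidth D a b ω n ≤ c / τ ^ n)
    {β : NNReal} (hβ : α < β) (K : NNReal) : ¬ HolderOnWith K β f (Icc a b) := by
  intro hK
  have hτ0 : 0 < τ := one_pos.trans hτ
  have hq : 0 < (m : ℝ) - 1 := hτα ▸ rpow_pos_of_pos hτ0 α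
  have hgrow : 1 < τ ^ (β : ℝ) / (m - 1) := by
    rw [one_lt_div hq, ← hτα]
    exact rpow_lt_rpow_of_exponent_lt hτ hβ
  suffices hbound : ∃ᶠ n in atTop, (τ ^ (β : ℝ) / (m - 1)) ^ n ≤ K * c ^ (β : ℝ) from
    hbound ((tendsto_pow_atTop_atTop_of_one_lt hgrow).eventually_gt_atTop _ |>.mono
      fun _ => not_le.2)
  refine hwidth.mono fun n hn => ?_
  have hwidth0 : 0 ≤ cylinderWidth D a b ω n :=
    sub_nonneg.2 (hD.wordMap_left_le_wordMap_right hω n)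
  have hc : 0 ≤ c := by
    simpa using (le_div_iff₀ (pow_pos hτ0 n)).1 (hwidth0.trans hn)
  have hjump : (((m : ℝ) - 1) ^ n)⁻¹ ≤ K * (c / τ ^ n) ^ (β : ℝ) :=
    (hD.inv_pow_le_mul_cylinderWidth_rpow hm hf hω hK n).trans (by gcongr)
  calc (τ ^ (β : ℝ) / (m - 1)) ^ n = (τ ^ (β : ℝ)) ^ n * (((m : ℝ) - 1) ^ n)⁻¹ := by
        rw [div_pow, div_eq_mul_inv]
    _ ≤ (τ ^ (β : ℝ)) ^ n * (K * (c / τ ^ n) ^ (β : ℝ)) := by gcongr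
    _ = K * c ^ (β : ℝ) := by
        rw [div_rpow hc (by positivity), ← rpow_pow_comm hτ0.le]
        field_simp

variable (hm : 2 < m) (hc : 0 < c) (hτ : 0 < τ) (hα : 0 ≤ α) (hτα : τ ^ α = (m : ℝ) - 1)
  (hwidth : ∀ ω ∈ digitSeq m, ∀ n, (c * τ ^ n)⁻¹ ≤ cylinderWidth D a b ω n)
include hm hc hτ hα hτα hwidth

-- At the level `n + 1` for which `(m - 1)⁻ⁿ ≥ (π_C ω' - π_C ω) / 2 > (m - 1)⁻⁽ⁿ⁺¹⁾`, the two
-- cylinders are not adjacent, so that a whole cylinder separates the points coded by `ω` and `ω'`.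
theorem piC_sub_le (hω : ω ∈ digitSeq m) (hω' : ω' ∈ digitSeq m) (hlt : piC m ω < piC m ω') :
    piC m ω' - piC m ω ≤ 2 * ((m : ℝ) - 1) * c ^ α *
      |coding D (Icc a b) ω' - coding D (Icc a b) ω| ^ α := by
  have hq := one_lt_natCast_sub_one hm
  have hδ : 0 < piC m ω' - piC m ω := sub_pos.2 hlt
  have hδ1 : piC m ω' - piC m ω ≤ 1 := by
    have hmem : ∀ υ ∈ digitSeq m, piC m υ ∈ Icc 0 1 :=
      fun υ hυ => (isShrinkingTiling_actC hm).coding_mem_cylinder hυ 0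
    linarith [(hmem ω hω).1, (hmem ω' hω').2]
  obtain ⟨n, hn, hn'⟩ : ∃ n : ℕ, ((m : ℝ) - 1) ^ n ≤ 2 / (piC m ω' - piC m ω) ∧
      2 / (piC m ω' - piC m ω) < ((m : ℝ) - 1) ^ (n + 1) :=
    exists_nat_pow_near ((one_le_div hδ).2 (hδ1.trans one_le_two)) hq
  have hindex := wordIndex_add_two_le hm hω hω' ((div_lt_comm₀ hδ (by positivity)).1 hn')
  obtain ⟨υ, hυ, hυle⟩ := hD.exists_cylinderWidth_le_sub hω hω' hindex
    (hD.coding_mem_cylinder hω _) (hD.coding_mem_cylinder hω' _)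
  have hgap : (c * τ ^ (n + 1))⁻¹ ≤ |coding D (Icc a b) ω' - coding D (Icc a b) ω| :=
    (hwidth υ hυ _).trans (hυle.trans (le_abs_self _))
  calc piC m ω' - piC m ω ≤ 2 / ((m : ℝ) - 1) ^ n := (le_div_comm₀ (by positivity) hδ).1 hn
    _ = 2 * ((m : ℝ) - 1) * c ^ α * ((c * τ ^ (n + 1))⁻¹) ^ α := by
      rw [inv_rpow (by positivity), mul_rpow hc.le (by positivity), ← rpow_pow_comm hτ.le, hτα,
        pow_succ']
      field_simp
    _ ≤ _ := by gcongr

theorem abs_piC_sub_le (hω : ω ∈ digitSeq m) (hω' : ω' ∈ digitSeq m) :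
    |piC m ω - piC m ω'| ≤ 2 * ((m : ℝ) - 1) * c ^ α *
      |coding D (Icc a b) ω - coding D (Icc a b) ω'| ^ α := by
  have hq := one_lt_natCast_sub_one hm
  rcases lt_trichotomy (piC m ω) (piC m ω') with h | h | h
  · rw [abs_sub_comm, abs_sub_comm (coding _ _ ω), abs_of_pos (sub_pos.2 h)]
    exact hD.piC_sub_le hm hc hτ hα hτα hwidth hω hω' h
  · rw [h, sub_self, abs_zero]
    positivity
  · rw [abs_of_pos (sub_pos.2 h)]
    exact hD.piC_sub_le hm hc hτ hα hτα hwidth hω' hω h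

end IsShrinkingTiling

/-! ### The maps `B_j` -/

section Mobius

variable {D : Matrix (Fin 2) (Fin 2) ℝ} {s : Set ℝ}

theorem continuousOn_mobius (hden : ∀ x ∈ s, 0 < D 1 0 * x + D 1 1) : ContinuousOn (mobius D) s :=
  ContinuousOn.div (by fun_prop) (by fun_prop) fun x hx => (hden x hx).ne'

theorem monotoneOn_mobius (hdet : 0 ≤ D.det) (hden : ∀ x ∈ s, 0 < D 1 0 * x + D 1 1) :
    MonotoneOn (mobius D) s := by
  intro x hx y hy hxy
  rw [mobius, mobius, div_le_div_iff₀ (hden x hx) (hden y hy), ← sub_nonneg]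
  have hmul := mul_nonneg hdet (sub_nonneg.2 hxy)
  rw [det_fin_two] at hmul
  linear_combination hmul

theorem mobius_apply_div_apply (D M : Matrix (Fin 2) (Fin 2) ℝ) {k : Fin 2} (hM : M 1 k ≠ 0) :
    mobius D (M 0 k / M 1 k) = (D * M) 0 k / (D * M) 1 k := by
  simp only [mobius, mul_apply, Fin.sum_univ_two]
  rw [← mul_div_mul_right _ _ hM]
  congr 1 <;> field_simp

end Mobius

section ActB

variable {m j : ℕ}

theorem B_eq (hm : 2 ≤ m) (j : ℕ) :
    B m j = !![sinRatio m j - lam m * sinRatio m (j - 1), sinRatio m (j - 1);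
      lam m * sinRatio m j + sinRatio m (j + 1) - lam m * (lam m * sinRatio m (j - 1) +
        sinRatio m j), lam m * sinRatio m (j - 1) + sinRatio m j] := by
  rw [B, A_eq hm, L_inv, L, mul_fin_two, mul_fin_two]
  congr! 3 <;> ring_nf

theorem L_inv_mul_L (m : ℕ) : (L m)⁻¹ * L m = 1 :=
  nonsing_inv_mul _ (by simp [L])

theorem det_B (hm : 2 ≤ m) (j : ℕ) : (B m j).det = 1 := by
  rw [B, L_inv, det_mul, det_mul, det_A hm]
  simp [L]

theorem actB_zero (hm : 2 ≤ m) (j : ℕ) :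
    actB m j 0 = sinRatio m (j - 1) / (lam m * sinRatio m (j - 1) + sinRatio m j) := by
  simp [actB, mobius, B_eq hm]

theorem actB_inv_lam (hm : 2 < m) (j : ℕ) :
    actB m j (lam m)⁻¹ = sinRatio m j / (lam m * sinRatio m j + sinRatio m (j + 1)) := by
  have h := lam_pos hm
  simp only [actB, mobius, B_eq hm.le, of_apply, cons_val', cons_val_zero, cons_val_one,
    cons_val_fin_one]
  rw [← mul_div_mul_right _ _ h.ne']
  congr 1 <;> field_simp <;> ring

theorem B_den_pos (hm : 2 < m) (hj : j ∈ Icc 1 (m - 1)) {x : ℝ} (hx : x ∈ Icc 0 (lam m)⁻¹) :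
    0 < B m j 1 0 * x + B m j 1 1 := by
  have hlam := lam_pos hm
  have h0 := sinRatio_digit_sub_one_nonneg hm.le hj
  have h1 := one_le_sinRatio_digit hm.le hj
  have h2 := sinRatio_digit_add_one_nonneg hm.le hj
  have hxlam : 0 ≤ 1 - lam m * x := sub_nonneg.2 ((le_inv_mul_iff₀ hlam).1 (by simpa using hx.2))
  have hx0 : 0 ≤ x := hx.1
  calc 0 < 1 - lam m * x + x * lam m := by linarith
    _ ≤ (1 - lam m * x) * sinRatio m j + x * (lam m * sinRatio m j) := by
      gcongr
      · exact le_mul_of_one_le_right hxlam h1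
      · exact le_mul_of_one_le_right hlam.le h1
    _ ≤ (1 - lam m * x) * (lam m * sinRatio m (j - 1) + sinRatio m j) +
        x * (lam m * sinRatio m j + sinRatio m (j + 1)) := by
      gcongr
      · exact le_add_of_nonneg_left (by positivity)
      · exact le_add_of_nonneg_right h2
    _ = B m j 1 0 * x + B m j 1 1 := by
      simp only [B_eq hm.le, of_apply, cons_val', cons_val_zero, cons_val_one, cons_val_fin_one]
      ring

theorem isTiling_actB (hm : 2 < m) : IsTiling m (actB m) 0 (lam m)⁻¹ where
  two_le := hm.le
  le := (inv_pos.2 (lam_pos hm)).le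
  continuousOn j hj := continuousOn_mobius fun x hx => B_den_pos hm hj hx
  monotoneOn j hj :=
    monotoneOn_mobius (by simp [det_B hm.le]) fun x hx => B_den_pos hm hj hx
  map_left := by simp [actB_zero hm.le]
  map_right := by
    have hcast : ((m - 1 : ℕ) : ℝ) = m - 1 := Nat.cast_pred (by lia)
    rw [actB_inv_lam hm, hcast, sinRatio_self_sub hm.le, sinRatio_one hm.le, sub_add_cancel,
      sinRatio_self hm.le]
    simp
  map_succ_left j _ := by simp [actB_zero hm.le, actB_inv_lam hm]

end ActB

/-! ### The cylinders of the maps `B_j` -/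

/-- The matrix `B_{ω(0)} ⋯ B_{ω(n-1)} L = L A_{ω(0)} ⋯ A_{ω(n-1)}`. The ends of the level-`n`
cylinder of `ω` are the quotients of the two entries in each of its columns. -/
def cylinderMatrix (m : ℕ) (ω : ℕ → ℕ) : ℕ → Matrix (Fin 2) (Fin 2) ℝ
  | 0 => L m
  | n + 1 => cylinderMatrix m ω n * A m (ω n)

section NonnegativeMatrices

theorem le_mul_apply_of_one_le_diag {ι κ : Type*} [Fintype κ] {M : Matrix ι κ ℝ}
    {E : Matrix κ κ ℝ} {i : ι} {k : κ} (hM : ∀ l, 0 ≤ M i l) (hE : ∀ l, 0 ≤ E l k)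
    (hdiag : 1 ≤ E k k) : M i k ≤ (M * E) i k :=
  calc M i k ≤ M i k * E k k := le_mul_of_one_le_right (hM k) hdiag
    _ ≤ (M * E) i k :=
      Finset.single_le_sum (f := fun l => M i l * E l k) (fun l _ => mul_nonneg (hM l) (hE l))
        (Finset.mem_univ k)

theorem mulVec_dotProduct_self_le {d : ℕ} (D : Matrix (Fin d) (Fin d) ℝ) (v : Fin d → ℝ) :
    D *ᵥ v ⬝ᵥ D *ᵥ v ≤ norm2 D ^ 2 * (v ⬝ᵥ v) := by
  have hnorm (w : Fin d → ℝ) : ‖WithLp.toLp 2 w‖ ^ 2 = w ⬝ᵥ w := by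
    rw [EuclideanSpace.real_norm_sq_eq]
    simp only [dotProduct, sq]
  rw [← hnorm, ← hnorm, ← mul_pow, norm2_eq_norm]
  exact pow_le_pow_left₀ (norm_nonneg _) (l2_opNorm_mulVec D (WithLp.toLp 2 v)) 2

variable {m j : ℕ} (hm : 2 ≤ m) (hj : j ∈ Icc 1 (m - 1))
include hm hj

theorem A_apply_nonneg (i k : Fin 2) : 0 ≤ A m j i k := by
  have h0 := sinRatio_digit_sub_one_nonneg hm hj
  have h1 := zero_le_one.trans (one_le_sinRatio_digit hm hj)
  have h2 := sinRatio_digit_add_one_nonneg hm hj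
  rw [A_eq hm]
  fin_cases i <;> fin_cases k
  exacts [h1, h0, h2, h1]

theorem one_le_A_diag (k : Fin 2) : 1 ≤ A m j k k := by
  have h := one_le_sinRatio_digit hm hj
  rw [A_eq hm]
  fin_cases k
  exacts [h, h]

end NonnegativeMatrices

section CylinderMatrix

variable {m : ℕ} {ω : ℕ → ℕ}

theorem cylinderMatrix_succ_left (m : ℕ) (ω : ℕ → ℕ) (n : ℕ) :
    cylinderMatrix m ω (n + 1) = B m (ω 0) * cylinderMatrix m (fun k => ω (k + 1)) n := by
  induction n with
  | zero => simp only [cylinderMatrix, B, mul_assoc, L_inv_mul_L, mul_one]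
  | succ n ih => rw [cylinderMatrix, ih, cylinderMatrix, mul_assoc]

theorem det_cylinderMatrix (hm : 2 ≤ m) (ω : ℕ → ℕ) (n : ℕ) : (cylinderMatrix m ω n).det = 1 := by
  induction n with
  | zero => simp [cylinderMatrix, L]
  | succ n ih => rw [cylinderMatrix, det_mul, ih, det_A hm, one_mul]

theorem one_le_cylinderMatrix (hm : 2 < m) (hω : ω ∈ digitSeq m) (n : ℕ) (k : Fin 2) :
    1 ≤ cylinderMatrix m ω n 1 k := by
  induction n generalizing k with
  | zero =>
    fin_cases k
    exacts [one_le_lam hm, le_rfl]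
  | succ n ih =>
    exact (ih k).trans (le_mul_apply_of_one_le_diag (fun l => zero_le_one.trans (ih l))
      (fun l => A_apply_nonneg hm.le (hω n) l k) (one_le_A_diag hm.le (hω n) k))

theorem cylinderMatrix_pos (hm : 2 < m) (hω : ω ∈ digitSeq m) (n : ℕ) (k : Fin 2) :
    0 < cylinderMatrix m ω n 1 k := one_pos.trans_le (one_le_cylinderMatrix hm hω n k)

theorem monotone_cylinderMatrix (hm : 2 < m) (hω : ω ∈ digitSeq m) (k : Fin 2) :
    Monotone fun n => cylinderMatrix m ω n 1 k :=
  monotone_nat_of_le_succ fun n =>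
    le_mul_apply_of_one_le_diag (fun l => (cylinderMatrix_pos hm hω n l).le)
      (fun l => A_apply_nonneg hm.le (hω n) l k) (one_le_A_diag hm.le (hω n) k)

theorem add_two_le_cylinderMatrix_add (hm : 2 < m) (hω : ω ∈ digitSeq m) (n : ℕ) :
    n + 2 ≤ cylinderMatrix m ω n 1 0 + cylinderMatrix m ω n 1 1 := by
  induction n with
  | zero =>
    have h0 := one_le_cylinderMatrix hm hω 0 0
    have h1 := one_le_cylinderMatrix hm hω 0 1
    push_cast
    linarith
  | succ n ih =>
    have hlam := one_le_lam hm
    have hrec := sinRatio_add_one_add_sub_one (m := m) (ω n)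
    have h0 := sinRatio_digit_sub_one_nonneg hm.le (hω n)
    have h1 := one_le_sinRatio_digit hm.le (hω n)
    have h2 := sinRatio_digit_add_one_nonneg hm.le (hω n)
    have hc := one_le_cylinderMatrix hm hω n 0
    have hd := one_le_cylinderMatrix hm hω n 1
    simp only [cylinderMatrix, A_eq hm.le, mul_apply, Fin.sum_univ_two, of_apply, cons_val',
      cons_val_zero, cons_val_one, cons_val_fin_one]
    push_cast
    generalize cylinderMatrix m ω n 1 0 = c at *
    generalize cylinderMatrix m ω n 1 1 = d at *
    calc (n : ℝ) + 1 + 2 ≤ c + d + lam m * sinRatio m (ω n) := by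
          linarith [one_le_mul_of_one_le_of_one_le hlam h1]
      _ = (c * 1 + 1 * sinRatio m (ω n + 1)) + (1 * sinRatio m (ω n - 1) + d * 1) := by
          rw [← hrec]
          ring
      _ ≤ _ := by gcongr

theorem cylinderMatrix_dotProduct_self_le (hm : 2 < m) (hω : ω ∈ digitSeq m) (n : ℕ) :
    cylinderMatrix m ω n 1 ⬝ᵥ cylinderMatrix m ω n 1 ≤ (lam m ^ 2 + 1) * (rho m ^ 2) ^ n := by
  induction n with
  | zero => simp [cylinderMatrix, L, sq]
  | succ n ih =>
    have hle : ω n ≤ m := (hω n).2.trans (Nat.sub_le m 1)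
    have hrow : cylinderMatrix m ω (n + 1) 1 = A m (m - ω n) *ᵥ cylinderMatrix m ω n 1 := by
      rw [cylinderMatrix, mul_apply_eq_vecMul, ← transpose_A hm.le hle, mulVec_transpose]
    calc cylinderMatrix m ω (n + 1) 1 ⬝ᵥ cylinderMatrix m ω (n + 1) 1
        ≤ norm2 (A m (m - ω n)) ^ 2 * (cylinderMatrix m ω n 1 ⬝ᵥ cylinderMatrix m ω n 1) := by
          rw [hrow]
          exact mulVec_dotProduct_self_le _ _
      _ ≤ rho m ^ 2 * ((lam m ^ 2 + 1) * (rho m ^ 2) ^ n) :=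
          mul_le_mul (pow_le_pow_left₀ (norm2_nonneg _) (norm2_A_le_rho hm (Nat.sub_le m _)) 2) ih
            (dotProduct_self_star_nonneg _) (sq_nonneg _)
      _ = (lam m ^ 2 + 1) * (rho m ^ 2) ^ (n + 1) := by ring

theorem wordMap_actB (hm : 2 < m) (hω : ω ∈ digitSeq m) (n : ℕ) (k : Fin 2) :
    wordMap (actB m) ω n (L m 0 k / L m 1 k) =
      cylinderMatrix m ω n 0 k / cylinderMatrix m ω n 1 k := by
  induction n generalizing ω with
  | zero => rfl
  | succ n ih =>
    have hω' := shift_mem_digitSeq hω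
    rw [wordMap, Function.comp_apply, ih hω', cylinderMatrix_succ_left, actB,
      mobius_apply_div_apply _ _ (cylinderMatrix_pos hm hω' n k).ne']

theorem cylinderWidth_actB (hm : 2 < m) (hω : ω ∈ digitSeq m) (n : ℕ) :
    cylinderWidth (actB m) 0 (lam m)⁻¹ ω n =
      (cylinderMatrix m ω n 1 0 * cylinderMatrix m ω n 1 1)⁻¹ := by
  have h0 := wordMap_actB hm hω n 0
  have h1 := wordMap_actB hm hω n 1
  have hdet := det_cylinderMatrix hm.le ω n
  have hc := (cylinderMatrix_pos hm hω n 0).ne'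
  have hd := (cylinderMatrix_pos hm hω n 1).ne'
  simp only [L, of_apply, cons_val', cons_val_zero, cons_val_one, cons_val_fin_one, one_div,
    div_one] at h0 h1
  rw [det_fin_two] at hdet
  rw [cylinderWidth, h0, h1, div_sub_div _ _ hc hd, ← one_div, ← hdet]
  ring

theorem isShrinkingTiling_actB (hm : 2 < m) : IsShrinkingTiling m (actB m) 0 (lam m)⁻¹ where
  toIsTiling := isTiling_actB hm
  tendsto_cylinderWidth ω hω := by
    have hD := isTiling_actB hm
    refine squeeze_zero (fun n => sub_nonneg.2 (hD.wordMap_left_le_wordMap_right hω n))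
      (fun n => ?_) tendsto_one_div_add_atTop_nhds_zero_nat
    have hc := one_le_cylinderMatrix hm hω n 0
    have hd := one_le_cylinderMatrix hm hω n 1
    have hsum := add_two_le_cylinderMatrix_add hm hω n
    rw [cylinderWidth_actB hm hω, one_div]
    refine inv_anti₀ (by positivity) ?_
    linarith [mul_nonneg (sub_nonneg.2 hc) (sub_nonneg.2 hd)]

theorem inv_le_cylinderWidth_actB (hm : 2 < m) (hω : ω ∈ digitSeq m) (n : ℕ) :
    ((lam m ^ 2 + 1) * (rho m ^ 2) ^ n)⁻¹ ≤ cylinderWidth (actB m) 0 (lam m)⁻¹ ω n := by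
  have hc := cylinderMatrix_pos hm hω n 0
  have hd := cylinderMatrix_pos hm hω n 1
  have hsq := cylinderMatrix_dotProduct_self_le hm hω n
  rw [dotProduct, Fin.sum_univ_two] at hsq
  rw [cylinderWidth_actB hm hω]
  refine inv_anti₀ (mul_pos hc hd) ?_
  linarith [sq_nonneg (cylinderMatrix m ω n 1 0 - cylinderMatrix m ω n 1 1), mul_pos hc hd]

end CylinderMatrix

/-! ### The sequence with the thinnest cylinders -/

/-- The periodic sequence `m - k, k, m - k, k, …` with `k = ⌊m/2⌋`, along which the cylinders of the
maps `B_j` shrink at the largest possible rate `ρ_m⁻²`. -/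
def alternating (m : ℕ) (i : ℕ) : ℕ := if Even i then m - m / 2 else m / 2

section Alternating

variable {m : ℕ}

theorem alternating_mem_digitSeq (hm : 2 ≤ m) : alternating m ∈ digitSeq m := by
  intro i
  unfold alternating
  split_ifs
  exacts [sub_half_mem_digits hm, half_mem_digits hm]

theorem cylinderMatrix_alternating (hm : 2 ≤ m) (n : ℕ) :
    cylinderMatrix m (alternating m) (2 * n) =
      L m * ((A m (m / 2))ᵀ * A m (m / 2)) ^ n := by
  induction n with
  | zero => simp [cylinderMatrix]
  | succ n ih =>
    have heven : alternating m (2 * n) = m - m / 2 := if_pos (even_two_mul n)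
    have hodd : alternating m (2 * n + 1) = m / 2 :=
      if_neg (Nat.not_even_iff_odd.2 (odd_two_mul_add_one n))
    rw [mul_add_one, cylinderMatrix, cylinderMatrix, ih, heven, hodd,
      transpose_A hm (Nat.div_le_self m 2), pow_succ, mul_assoc, mul_assoc]

theorem le_cylinderMatrix_alternating (hm : 2 < m) (n : ℕ) (k : Fin 2) :
    (1 - (rho m ^ 2)⁻¹) * (rho m ^ 2) ^ n ≤
      cylinderMatrix m (alternating m) (2 * (n + 1)) 1 k := by
  have hω := alternating_mem_digitSeq hm.le
  have hone := one_le_cylinderMatrix hm hω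
  have hmono := monotone_cylinderMatrix hm hω k (Nat.zero_le 2)
  have hA : (A m (m / 2)).det = 1 := det_A hm.le _
  have hperiod := cylinderMatrix_alternating hm.le
  rw [hperiod]
  refine le_mul_pow_succ_apply (one_lt_pow₀ (one_lt_rho hm) two_ne_zero)
    (by rw [det_mul, det_transpose, hA, one_mul]) (trace_transpose_mul_self hA) (M := L m) (i := 1)
    (hone 0 k) ?_ ?_
  · have h2 := hperiod 1
    rw [pow_one, mul_one] at h2
    rwa [← h2]
  · rw [← hperiod]
    exact zero_le_one.trans (hone _ k)

theorem frequently_cylinderWidth_alternating_le (hm : 2 < m) :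
    ∃ᶠ n in atTop, cylinderWidth (actB m) 0 (lam m)⁻¹ (alternating m) n ≤
      (rho m ^ 2 / (1 - (rho m ^ 2)⁻¹)) ^ 2 / (rho m ^ 2) ^ n := by
  refine frequently_atTop.2 fun n => ⟨2 * (n + 1), by lia, ?_⟩
  have hτ : 1 < rho m ^ 2 := one_lt_pow₀ (one_lt_rho hm) two_ne_zero
  have h0 := le_cylinderMatrix_alternating hm n 0
  have h1 := le_cylinderMatrix_alternating hm n 1
  have hpos := cylinderMatrix_pos hm (alternating_mem_digitSeq hm.le) (2 * (n + 1)) 0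
  rw [cylinderWidth_actB hm (alternating_mem_digitSeq hm.le)]
  generalize rho m ^ 2 = τ at *
  have hκ : 0 < 1 - τ⁻¹ := sub_pos.2 (inv_lt_one_of_one_lt₀ hτ)
  calc _ ≤ ((1 - τ⁻¹) * τ ^ n * ((1 - τ⁻¹) * τ ^ n))⁻¹ := by gcongr
    _ = (τ / (1 - τ⁻¹)) ^ 2 / τ ^ (2 * (n + 1)) := by
      generalize 1 - τ⁻¹ = κ at *
      field_simp
      ring

end Alternating

/-! ### The Minkowski function -/

section Minkowski

variable {m : ℕ}

theorem alpha_pos (hm : 2 < m) : 0 < alpha m :=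
  div_pos (log_pos (one_lt_natCast_sub_one hm)) (mul_pos two_pos (log_pos (one_lt_rho hm)))

theorem rho_sq_rpow_alpha (hm : 2 < m) : (rho m ^ 2) ^ alpha m = (m : ℝ) - 1 := by
  have hρ := one_lt_rho hm
  have hlog := log_pos hρ
  have hq := one_lt_natCast_sub_one hm
  rw [rpow_def_of_pos (by positivity), log_pow, Nat.cast_ofNat, alpha,
    mul_div_cancel₀ _ (by positivity), exp_log (by positivity)]

theorem image_piB (hm : 2 < m) : piB m '' digitSeq m = dom m :=
  (isShrinkingTiling_actB hm).image_coding_digitSeq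

theorem abs_piC_sub_le_abs_piB_sub (hm : 2 < m) {ω ω' : ℕ → ℕ} (hω : ω ∈ digitSeq m)
    (hω' : ω' ∈ digitSeq m) :
    |piC m ω - piC m ω'| ≤
      2 * ((m : ℝ) - 1) * (lam m ^ 2 + 1) ^ alpha m * |piB m ω - piB m ω'| ^ alpha m :=
  (isShrinkingTiling_actB hm).abs_piC_sub_le hm (by positivity)
    (pow_pos (one_pos.trans (one_lt_rho hm)) 2) (alpha_pos hm).le (rho_sq_rpow_alpha hm)
    (fun _ hω => inv_le_cylinderWidth_actB hm hω) hω hω'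

theorem minkowski_piB (hm : 2 < m) {ω : ℕ → ℕ} (hω : ω ∈ digitSeq m) :
    minkowski m (piB m ω) = piC m ω := by
  have hex : ∃ υ ∈ digitSeq m, piB m υ = piB m ω := ⟨ω, hω, rfl⟩
  have h := abs_piC_sub_le_abs_piB_sub hm (Function.invFunOn_mem hex) hω
  rw [Function.invFunOn_eq hex, sub_self, abs_zero, zero_rpow (alpha_pos hm).ne', mul_zero,
    abs_nonpos_iff, sub_eq_zero] at h
  exact h

theorem exists_holderOnWith_minkowski (hm : 2 < m) {α : NNReal} (hα : (α : ℝ) = alpha m) :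
    ∃ K : NNReal, HolderOnWith K α (minkowski m) (dom m) := by
  have hq := one_lt_natCast_sub_one hm
  refine ⟨⟨2 * ((m : ℝ) - 1) * (lam m ^ 2 + 1) ^ alpha m, by positivity⟩,
    holderOnWith_iff_abs_sub_le.2 ?_⟩
  rw [← image_piB hm, hα]
  rintro _ ⟨ω, hω, rfl⟩ _ ⟨ω', hω', rfl⟩
  rw [minkowski_piB hm hω, minkowski_piB hm hω']
  exact abs_piC_sub_le_abs_piB_sub hm hω hω'

theorem not_holderOnWith_minkowski (hm : 2 < m) {β : NNReal} (hβ : alpha m < β) (K : NNReal) :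
    ¬ HolderOnWith K β (minkowski m) (dom m) :=
  (isShrinkingTiling_actB hm).not_holderOnWith hm (fun _ hω => minkowski_piB hm hω)
    (alternating_mem_digitSeq hm.le) (one_lt_pow₀ (one_lt_rho hm) two_ne_zero)
    (rho_sq_rpow_alpha hm) (frequently_cylinderWidth_alternating_le hm) hβ K

end Minkowski

end

end HeckeMinkowski

theorem theorem4 (m : ℕ) (hm : 3 ≤ m) :
    -- the Minkowski function is well defined on `[0, λ_m⁻¹]`
    ((∀ ω ∈ HeckeMinkowski.digitSeq m,
        ⋂ n, HeckeMinkowski.cylinder (HeckeMinkowski.actB m) (HeckeMinkowski.dom m) ω n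
          = {HeckeMinkowski.piB m ω} ∧
        ⋂ n, HeckeMinkowski.cylinder (HeckeMinkowski.actC m) (Set.Icc 0 1) ω n
          = {HeckeMinkowski.piC m ω} ∧
        HeckeMinkowski.minkowski m (HeckeMinkowski.piB m ω) = HeckeMinkowski.piC m ω) ∧
      HeckeMinkowski.piB m '' HeckeMinkowski.digitSeq m = HeckeMinkowski.dom m) ∧
    -- the joint spectral radius
    HeckeMinkowski.jointSpectralRadius (HeckeMinkowski.A m '' Set.Icc 1 (m - 1))
      = HeckeMinkowski.rho m ∧
    -- the optimal Hölder exponent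
    ∃ α : NNReal, (α : ℝ) = HeckeMinkowski.alpha m ∧
      (∃ K : NNReal,
        HolderOnWith K α (HeckeMinkowski.minkowski m) (HeckeMinkowski.dom m)) ∧
      ∀ β : NNReal, α < β →
        ¬ ∃ K : NNReal,
          HolderOnWith K β (HeckeMinkowski.minkowski m) (HeckeMinkowski.dom m) := by
  refine ⟨⟨fun ω hω => ⟨(HeckeMinkowski.isShrinkingTiling_actB hm).iInter_cylinder_eq_coding hω,
    (HeckeMinkowski.isShrinkingTiling_actC hm).iInter_cylinder_eq_coding hω,
    HeckeMinkowski.minkowski_piB hm hω⟩, HeckeMinkowski.image_piB hm⟩,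
    HeckeMinkowski.jointSpectralRadius_A hm,
    ⟨HeckeMinkowski.alpha m, (HeckeMinkowski.alpha_pos hm).le⟩, rfl,
    HeckeMinkowski.exists_holderOnWith_minkowski hm rfl, ?_⟩
  rintro β hβ ⟨K, hK⟩
  exact HeckeMinkowski.not_holderOnWith_minkowski hm (by exact_mod_cast hβ) K hK
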